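/- Let $B$ be a connected subset of $\mathbb{C}^2$, with coordinates $(z,\delta)$, that contains $\mathbb{C}\times\{-2\}$, and let $\mathcal{M}$ be the field of meromorphic functions in $(z,\delta)$ defined on an open superset of $B$ (equality being equality of functions near $B$). Let $x,y\in\mathcal{M}$ satisfy $$(z^3+\delta z^2+z)\,y^2=x^3+\delta x^2+x,$$ and assume that $\delta+2$ is neither a zero nor a pole of $y$, i.e. that $y$ has order $0$ along the line $\delta=-2$ (in particular $y\neq 0$). Put $A_{xy}=x_z/y\in\mathcal{M}$, where $x_z=\partial x/\partial z$. Then $A_{xy}$ is analytic at $(z,\delta)=(1,-2)$, and its value there is a rational integer $n$. Moreover both iterated evaluations are defined and agree with this value: $$A_{xy}\big|_{z=1,\ \delta=-2}=A_{xy}\big|_{\delta=-2,\ z=1}=n\in\mathbb{Z}.$$ Here $A_{xy}|_{z=1,\delta=-2}$ means restricting first to $z=1$ and then evaluating at $\delta=-2$, and $A_{xy}|_{\delta=-2,z=1}$ means the same in the opposite order. -/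

import Mathlib

open Filter Topology

/-! Meromorphic functions of the two complex variables `(z, δ)`, a point of `ℂ × ℂ` being written
`q = (z, δ)`.  As for Mathlib's one-variable `MeromorphicAt`, a meromorphic function is represented
by a total function `ℂ × ℂ → ℂ` whose values on a thin analytic set (poles, points of
indeterminacy) do not matter; accordingly, equality of meromorphic functions is equality outside a
thin analytic set. -/

/-- `f` and `g` agree near `p` outside a thin analytic set, that is, outside the zero set of an
analytic germ `c ≠ 0`.  For meromorphic `f` and `g` this is equality of their germs at `p`. -/
def MeroEqAt (f g : ℂ × ℂ → ℂ) (p : ℂ × ℂ) : Prop :=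
  ∃ c : ℂ × ℂ → ℂ, AnalyticAt ℂ c p ∧ (¬ ∀ᶠ q in 𝓝 p, c q = 0) ∧
    ∀ᶠ q in 𝓝 p, c q ≠ 0 → f q = g q

/-- `f` is meromorphic at `p`: near `p` it is a quotient of analytic functions, the denominator
not being identically zero near `p`. -/
def MeroAt (f : ℂ × ℂ → ℂ) (p : ℂ × ℂ) : Prop :=
  ∃ a b : ℂ × ℂ → ℂ, AnalyticAt ℂ a p ∧ AnalyticAt ℂ b p ∧ (¬ ∀ᶠ q in 𝓝 p, b q = 0) ∧
    MeroEqAt f (fun q => a q / b q) p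

/-- `f` is (a representative of) an element of the field `𝓜(B)` of functions that are meromorphic
on an open superset of `B`. -/
def MeroNear (B : Set (ℂ × ℂ)) (f : ℂ × ℂ → ℂ) : Prop :=
  ∃ U : Set (ℂ × ℂ), IsOpen U ∧ B ⊆ U ∧ ∀ p ∈ U, MeroAt f p

/-- Equality in `𝓜(B)`. -/
def MeroEqNear (B : Set (ℂ × ℂ)) (f g : ℂ × ℂ → ℂ) : Prop :=
  ∃ U : Set (ℂ × ℂ), IsOpen U ∧ B ⊆ U ∧ ∀ p ∈ U, MeroEqAt f g p

/-- The Manin-Denef equation `(z³ + δz² + z) y² = x³ + δx² + x`, as an identity in `𝓜(B)`. -/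
def ManinDenef (B : Set (ℂ × ℂ)) (x y : ℂ × ℂ → ℂ) : Prop :=
  MeroEqNear B (fun q => (q.1 ^ 3 + q.2 * q.1 ^ 2 + q.1) * y q ^ 2)
    (fun q => x q ^ 3 + q.2 * x q ^ 2 + x q)

/-- The partial derivative `g_z`. -/
noncomputable def partialZ (g : ℂ × ℂ → ℂ) : ℂ × ℂ → ℂ :=
  fun q => deriv (fun t => g (t, q.2)) q.1

/-- `A_{xy} = x_z / y`. -/
noncomputable def quotA (x y : ℂ × ℂ → ℂ) : ℂ × ℂ → ℂ :=
  fun q => partialZ x q / y q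

/-- The order of `g` at the irreducible `δ - p.2` of the ring of analytic germs at `p` is `k`:
near `p` one has `g = (δ - p.2)^k a / b` with `a` and `b` analytic and not divisible by `δ - p.2`,
that is, not vanishing identically on the line `δ = p.2` near `p`. -/
def HasDeltaOrderAt (g : ℂ × ℂ → ℂ) (p : ℂ × ℂ) (k : ℤ) : Prop :=
  ∃ a b : ℂ × ℂ → ℂ, AnalyticAt ℂ a p ∧ AnalyticAt ℂ b p ∧
    (¬ ∀ᶠ z in 𝓝 p.1, a (z, p.2) = 0) ∧ (¬ ∀ᶠ z in 𝓝 p.1, b (z, p.2) = 0) ∧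
    MeroEqAt g (fun q => (q.2 - p.2) ^ k * (a q / b q)) p

/-- `δ - d` is neither a zero nor a pole of `g`: the order of `g` along the line `δ = d` is zero.
(The line being connected, the order is the same at all of its points.) -/
def NeitherZeroNorPole (g : ℂ × ℂ → ℂ) (d : ℂ) : Prop :=
  ∀ z : ℂ, HasDeltaOrderAt g (z, d) 0

/-- The meromorphic function `g` is analytic at `p`, where it takes the value `v`. -/
def HasValueAt (g : ℂ × ℂ → ℂ) (p : ℂ × ℂ) (v : ℂ) : Prop :=
  ∃ a : ℂ × ℂ → ℂ, AnalyticAt ℂ a p ∧ MeroEqAt g a p ∧ a p = v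

/-- For a parametrised line `ι`: the restriction of the meromorphic function `g` to `ι` is well
defined near `ι t₀` (the line is not contained in the polar set of `g`) and is, as a
meromorphic germ at `t₀` in one variable, equal to `r`. -/
def HasRestrictionAt (g : ℂ × ℂ → ℂ) (ι : ℂ → ℂ × ℂ) (t₀ : ℂ) (r : ℂ → ℂ) : Prop :=
  ∃ a b : ℂ × ℂ → ℂ, AnalyticAt ℂ a (ι t₀) ∧ AnalyticAt ℂ b (ι t₀) ∧
    (¬ ∀ᶠ t in 𝓝 t₀, b (ι t) = 0) ∧ MeroEqAt g (fun q => a q / b q) (ι t₀) ∧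
    r =ᶠ[𝓝[≠] t₀] fun t => a (ι t) / b (ι t)

/-- The value of `g` on first restricting to `z = p.1`, then evaluating the resulting meromorphic
function of `δ` at `δ = p.2`, is defined and equals `v`. -/
def HasValueZThenDelta (g : ℂ × ℂ → ℂ) (p : ℂ × ℂ) (v : ℂ) : Prop :=
  ∃ r : ℂ → ℂ, HasRestrictionAt g (fun δ => (p.1, δ)) p.2 r ∧ Tendsto r (𝓝[≠] p.2) (𝓝 v)

/-- The value of `g` on first restricting to `δ = p.2`, then evaluating the resulting meromorphic
function of `z` at `z = p.1`, is defined and equals `v`. -/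
def HasValueDeltaThenZ (g : ℂ × ℂ → ℂ) (p : ℂ × ℂ) (v : ℂ) : Prop :=
  ∃ r : ℂ → ℂ, HasRestrictionAt g (fun z => (z, p.2)) p.1 r ∧ Tendsto r (𝓝[≠] p.1) (𝓝 v)

/-!
The assertion is local at `(z, δ) = (1, -2)`.  Write `f(z) = z³ + δz² + z` and `A = x_z / y`.

Since `f(z) y² = x³ + δx² + x` and `y` has no pole along `δ = -2`, neither has `x`
(`exists_div_of_maninDenef`).  As moreover `y` does not vanish along this line, `A` is a quotient of
analytic germs whose denominator is not divisible by `δ + 2`, hence has no zero on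
`{|z - 1| = r} × {|δ + 2| ≤ ρ}` for suitable small `r` and `ρ`.

On a fibre with `δ ≠ ±2` the equation `w² = f(z)` defines an elliptic curve, `(z, w) ↦ (x, y w)` is a
map from (a piece of) this curve to itself, and `A` is the factor by which it multiplies the
invariant differential `dz / w`; so `A` has no poles on the fibre.  This is a comparison of orders
in one variable (`meromorphicOrderAt_deriv_div_nonneg`).  Consequently the Cauchy integral of `A`
over `|z - 1| = r`, which is jointly analytic, equals `A` on all fibres `δ ≠ -2` near `-2`, and `A`
is analytic at `(1, -2)` (`exists_analytic_extension`, `exists_analytic_quotient`).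

By continuity the value can then be computed on the line `δ = -2`, where the equation degenerates to
`z(z-1)² y² = x(x-1)²`.  Here `x = T²` for a meromorphic germ `T` at `z = 1`, and `A` equals
`√z (z-1) (T'/(T-1) - T'/(T+1))`, whose value at `1` is a difference of orders of vanishing
(`exists_int_eq_of_nodal`).
-/

/-! ### Cauchy integrals and removable singularities -/

open Metric in
/-- A double Cauchy integral over a torus is jointly analytic in the two parameters.  The kernel is
the inverse, in the Banach algebra of bounded continuous functions of the two angles, of an element
depending polynomially on `q`; inversion is analytic on units, and the integral against `φ` is a
continuous linear functional. -/
theorem analyticAt_torusCauchy {φ : ℝ × ℝ → ℂ} (hφ : Continuous φ) {c d : ℂ} {r ρ : ℝ}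
    {q₀ : ℂ × ℂ} (h₁ : q₀.1 ∈ ball c r) (h₂ : q₀.2 ∈ ball d ρ) :
    AnalyticAt ℂ (fun q : ℂ × ℂ => ∫ θ in (0 : ℝ)..2 * Real.pi, ∫ ψ in (0 : ℝ)..2 * Real.pi,
      φ (θ, ψ) * ((circleMap c r θ - q.1) * (circleMap d ρ ψ - q.2))⁻¹) q₀ := by
  have hr : 0 < r := pos_of_mem_ball h₁
  have hρ : 0 < ρ := pos_of_mem_ball h₂
  have bdd : ∀ (c : ℂ) (r : ℝ), 0 < r → ∀ θ, ‖circleMap c r θ‖ ≤ ‖c‖ + r := fun c r hr θ => by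
    have := circleMap_mem_closedBall c hr.le θ
    rw [mem_closedBall, dist_eq_norm] at this
    have := norm_add_le c (circleMap c r θ - c)
    rw [add_sub_cancel] at this; linarith
  let Z : BoundedContinuousFunction (ℝ × ℝ) ℂ := BoundedContinuousFunction.ofNormedAddCommGroup
    (fun t => circleMap c r t.1) (by fun_prop) (‖c‖ + r) (fun t => bdd c r hr t.1)
  let H : BoundedContinuousFunction (ℝ × ℝ) ℂ := BoundedContinuousFunction.ofNormedAddCommGroup
    (fun t => circleMap d ρ t.2) (by fun_prop) (‖d‖ + ρ) (fun t => bdd d ρ hρ t.2)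
  let P : ℂ × ℂ → BoundedContinuousFunction (ℝ × ℝ) ℂ := fun q =>
    (Z - q.1 • 1) * (H - q.2 • 1)
  have hPa : ∀ q, AnalyticAt ℂ P q := fun q => by
    have h1 : AnalyticAt ℂ (fun q : ℂ × ℂ => Z - q.1 • (1 : BoundedContinuousFunction (ℝ × ℝ) ℂ)) q :=
      analyticAt_const.sub (analyticAt_fst.smul analyticAt_const)
    have h2 : AnalyticAt ℂ (fun q : ℂ × ℂ => H - q.2 • (1 : BoundedContinuousFunction (ℝ × ℝ) ℂ)) q :=
      analyticAt_const.sub (analyticAt_snd.smul analyticAt_const)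
    exact h1.mul h2
  have hPapp : ∀ q t, P q t = (circleMap c r t.1 - q.1) * (circleMap d ρ t.2 - q.2) := by
    intro q t
    simp [P, Z, H]
  have gap : ∀ {c : ℂ} {r : ℝ} {z : ℂ}, z ∈ ball c r → ∀ θ,
      r - dist z c ≤ ‖circleMap c r θ - z‖ := fun {c r z} hz θ => by
    have hr := pos_of_mem_ball hz
    have h := circleMap_mem_sphere c hr.le θ
    rw [mem_sphere] at h
    have := dist_triangle (circleMap c r θ) z c
    rw [← dist_eq_norm]; linarith
  have hunit : ∀ q : ℂ × ℂ, q.1 ∈ ball c r → q.2 ∈ ball d ρ → IsUnit (P q) := by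
    intro q hq₁ hq₂
    have p1 : 0 < r - dist q.1 c := by rw [mem_ball] at hq₁; linarith
    have p2 : 0 < ρ - dist q.2 d := by rw [mem_ball] at hq₂; linarith
    have low : ∀ t, (r - dist q.1 c) * (ρ - dist q.2 d) ≤ ‖P q t‖ := fun t => by
      rw [hPapp, norm_mul]
      exact mul_le_mul (gap hq₁ _) (gap hq₂ _) p2.le (norm_nonneg _)
    have hne : ∀ t, P q t ≠ 0 := fun t => norm_pos_iff.1 (lt_of_lt_of_le (mul_pos p1 p2) (low t))
    let I : BoundedContinuousFunction (ℝ × ℝ) ℂ := BoundedContinuousFunction.ofNormedAddCommGroup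
      (fun t => (P q t)⁻¹) ((P q).continuous.inv₀ hne) ((r - dist q.1 c) * (ρ - dist q.2 d))⁻¹
      (fun t => by
        rw [norm_inv]
        exact inv_anti₀ (mul_pos p1 p2) (low t))
    refine IsUnit.of_mul_eq_one I ?_
    ext t
    simp [I, hne t]
  have hinv : ∀ q : ℂ × ℂ, q.1 ∈ ball c r → q.2 ∈ ball d ρ → ∀ t,
      Ring.inverse (P q) t = ((circleMap c r t.1 - q.1) * (circleMap d ρ t.2 - q.2))⁻¹ := by
    intro q hq₁ hq₂ t
    have h := congrArg (fun f : BoundedContinuousFunction (ℝ × ℝ) ℂ => f t)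
      (Ring.mul_inverse_cancel _ (hunit q hq₁ hq₂))
    rw [← hPapp]
    exact eq_inv_of_mul_eq_one_right h
  have hcont : ∀ k : BoundedContinuousFunction (ℝ × ℝ) ℂ, Continuous fun θ : ℝ =>
      ∫ ψ in (0 : ℝ)..2 * Real.pi, φ (θ, ψ) * k (θ, ψ) := fun k => by
    refine intervalIntegral.continuous_parametric_intervalIntegral_of_continuous' ?_ _ _
    have := k.continuous
    simp only [Function.uncurry_def]
    fun_prop
  have hcont' : ∀ (k : BoundedContinuousFunction (ℝ × ℝ) ℂ) (θ : ℝ), Continuous fun ψ : ℝ =>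
      φ (θ, ψ) * k (θ, ψ) := fun k θ => by
    have := k.continuous
    fun_prop
  obtain ⟨C, hC⟩ : ∃ C, ∀ t ∈ Set.Icc (0 : ℝ) (2 * Real.pi) ×ˢ Set.Icc (0 : ℝ) (2 * Real.pi),
      ‖φ t‖ ≤ C :=
    (isCompact_Icc.prod isCompact_Icc).exists_bound_of_continuousOn hφ.continuousOn
  have hpi : (0 : ℝ) ≤ 2 * Real.pi := by positivity
  have hsub : Set.uIoc (0 : ℝ) (2 * Real.pi) ⊆ Set.Icc 0 (2 * Real.pi) := by
    rw [Set.uIoc_of_le hpi]; exact Set.Ioc_subset_Icc_self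
  let L : BoundedContinuousFunction (ℝ × ℝ) ℂ →ₗ[ℂ] ℂ :=
    { toFun := fun k => ∫ θ in (0 : ℝ)..2 * Real.pi, ∫ ψ in (0 : ℝ)..2 * Real.pi,
        φ (θ, ψ) * k (θ, ψ)
      map_add' := fun k l => by
        rw [← intervalIntegral.integral_add ((hcont k).intervalIntegrable _ _)
          ((hcont l).intervalIntegrable _ _)]
        congr 1; ext θ
        rw [← intervalIntegral.integral_add ((hcont' k θ).intervalIntegrable _ _)
          ((hcont' l θ).intervalIntegrable _ _)]
        congr 1; ext ψ
        simp [mul_add]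
      map_smul' := fun a k => by
        simp only [BoundedContinuousFunction.coe_smul, smul_eq_mul, RingHom.id_apply, mul_left_comm,
          intervalIntegral.integral_const_mul] }
  let Λ : BoundedContinuousFunction (ℝ × ℝ) ℂ →L[ℂ] ℂ :=
    L.mkContinuous (C * (2 * Real.pi) * (2 * Real.pi)) fun k => by
      have h1 : ∀ θ ∈ Set.uIoc (0 : ℝ) (2 * Real.pi),
          ‖∫ ψ in (0 : ℝ)..2 * Real.pi, φ (θ, ψ) * k (θ, ψ)‖ ≤ C * ‖k‖ * |2 * Real.pi - 0| := by
        intro θ hθ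
        refine intervalIntegral.norm_integral_le_of_norm_le_const fun ψ hψ => ?_
        rw [norm_mul]
        have h := hC (θ, ψ) ⟨hsub hθ, hsub hψ⟩
        exact mul_le_mul h (k.norm_coe_le_norm _) (norm_nonneg _) ((norm_nonneg _).trans h)
      have := intervalIntegral.norm_integral_le_of_norm_le_const h1
      rw [sub_zero, abs_of_nonneg hpi] at this
      exact this.trans_eq (by ring)
  have hana : AnalyticAt ℂ (fun q => Λ (Ring.inverse (P q))) q₀ := by
    have h := hunit q₀ h₁ h₂
    have hi : AnalyticAt ℂ Ring.inverse (P q₀) := by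
      obtain ⟨u, hu⟩ := h
      rw [← hu]; exact analyticAt_inverse u
    exact (Λ.analyticAt _).comp (hi.comp (hPa q₀))
  refine hana.congr ?_
  have hU : ball c r ×ˢ ball d ρ ∈ 𝓝 q₀ := (isOpen_ball.prod isOpen_ball).mem_nhds ⟨h₁, h₂⟩
  filter_upwards [hU] with q hq
  simp only [Λ, LinearMap.mkContinuous_apply, L, LinearMap.coe_mk, AddHom.coe_mk, hinv q hq.1 hq.2]

open Metric in
/-- The Cauchy integral of `A` in the first variable is jointly analytic, although `A` is
controlled only near the boundary circle `|ζ - c| = r`: Cauchy's formula in the second variable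
turns it into a double Cauchy integral. -/
theorem exists_analytic_cauchy_fst {A : ℂ × ℂ → ℂ} {c d : ℂ} {r ρ : ℝ} (hr : 0 < r) (hρ : 0 < ρ)
    (hA : ContinuousOn A (sphere c r ×ˢ sphere d ρ))
    (hdiff : ∀ ζ ∈ sphere c r, DiffContOnCl ℂ (fun η => A (ζ, η)) (ball d ρ)) :
    ∃ F : ℂ × ℂ → ℂ, AnalyticOnNhd ℂ F (ball c r ×ˢ ball d ρ) ∧
      ∀ z ∈ ball c r, ∀ η ∈ ball d ρ,
        F (z, η) = (2 * Real.pi * Complex.I)⁻¹ • ∮ ζ in C(c, r), (ζ - z)⁻¹ • A (ζ, η) := by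
  let φ : ℝ × ℝ → ℂ := fun t => (2 * Real.pi * Complex.I)⁻¹ * (2 * Real.pi * Complex.I)⁻¹ *
    (deriv (circleMap c r) t.1 * deriv (circleMap d ρ) t.2 * A (circleMap c r t.1, circleMap d ρ t.2))
  have hφ : Continuous φ := by
    have : Continuous fun t : ℝ × ℝ => A (circleMap c r t.1, circleMap d ρ t.2) :=
      hA.comp_continuous (by fun_prop) fun t =>
        ⟨circleMap_mem_sphere c hr.le _, circleMap_mem_sphere d hρ.le _⟩
    simp only [φ, deriv_circleMap]
    exact continuous_const.mul (Continuous.mul (by fun_prop) this)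
  refine ⟨_, fun q hq => analyticAt_torusCauchy hφ hq.1 hq.2, fun z hz η hη => ?_⟩
  rw [circleIntegral, ← intervalIntegral.integral_smul]
  congr 1; ext θ
  rw [← (hdiff _ (circleMap_mem_sphere c hr.le θ)).two_pi_i_inv_smul_circleIntegral_sub_inv_smul hη,
    circleIntegral]
  simp only [smul_eq_mul, ← intervalIntegral.integral_const_mul]
  congr 1; ext ψ
  simp only [φ, mul_inv]
  ring

open Metric in
/-- Simultaneous removal of all singularities of nonnegative order; the values at points where `f`
is already continuous are kept. -/
theorem exists_analyticOnNhd_of_meromorphicOrderAt_nonneg {f : ℂ → ℂ} {K : Set ℂ}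
    (hf : MeromorphicOn f K) (hord : ∀ x ∈ K, 0 ≤ meromorphicOrderAt f x) :
    ∃ h : ℂ → ℂ, AnalyticOnNhd ℂ h K ∧ (∀ x ∈ K, h =ᶠ[𝓝[≠] x] f) ∧
      ∀ x ∈ K, ContinuousAt f x → h x = f x := by
  have hana : AnalyticOnNhd ℂ (toMeromorphicNFOn f K) K := fun x hx =>
    ((meromorphicNFOn_toMeromorphicNFOn f K hx).meromorphicOrderAt_nonneg_iff_analyticAt).1
      (by rw [meromorphicOrderAt_toMeromorphicNFOn hf hx]; exact hord x hx)
  have heq : ∀ x ∈ K, toMeromorphicNFOn f K =ᶠ[𝓝[≠] x] f := fun x hx =>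
    hf.toMeromorphicNFOn_eq_self_on_nhdsNE hx
  exact ⟨_, hana, heq, fun x hx hc =>
    ((hana x hx).continuousAt.eventuallyEq_nhds_iff_eventuallyEq_nhdsNE hc).1 (heq x hx)
      |>.eq_of_nhds⟩

open Metric in
/-- A Hartogs-type extension principle.  If `A` is analytic near `sphere c r × closedBall d ρ` and
its slices `A(·, η)`, for `η ∈ S`, have only removable singularities in the disc, then `A` has a
jointly analytic extension over those slices.  Nothing is assumed about `A` at the interior points
of the slices with `η ∉ S`. -/
theorem exists_analytic_extension {A : ℂ × ℂ → ℂ} {c d : ℂ} {r ρ : ℝ} (hr : 0 < r) (hρ : 0 < ρ)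
    {S : Set ℂ} (hS : S ⊆ ball d ρ)
    (hA : ∀ ζ ∈ sphere c r, ∀ η ∈ closedBall d ρ, AnalyticAt ℂ A (ζ, η))
    (hmer : ∀ η ∈ S, MeromorphicOn (fun ζ => A (ζ, η)) (closedBall c r))
    (hord : ∀ η ∈ S, ∀ z ∈ closedBall c r, 0 ≤ meromorphicOrderAt (fun ζ => A (ζ, η)) z) :
    ∃ F : ℂ × ℂ → ℂ, AnalyticOnNhd ℂ F (ball c r ×ˢ ball d ρ) ∧
      ∀ η ∈ S, ∀ z ∈ ball c r, (fun ζ => F (ζ, η)) =ᶠ[𝓝[≠] z] fun ζ => A (ζ, η) := by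
  obtain ⟨F, hF, hFeq⟩ := exists_analytic_cauchy_fst (A := A) (c := c) (d := d) hr hρ
    (fun q hq => (hA q.1 hq.1 q.2 (sphere_subset_closedBall hq.2)).continuousAt.continuousWithinAt)
    (fun ζ hζ => by
      refine DifferentiableOn.diffContOnCl fun η hη => ?_
      rw [closure_ball _ hρ.ne'] at hη
      exact (hA ζ hζ η hη).along_snd.differentiableAt.differentiableWithinAt)
  refine ⟨F, hF, fun η hη z hz => ?_⟩
  obtain ⟨h, hh, hhA, hval⟩ := exists_analyticOnNhd_of_meromorphicOrderAt_nonneg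
    (hmer η hη) (hord η hη)
  have key : ∀ w ∈ ball c r, F (w, η) = h w := fun w hw => by
    have hd : DiffContOnCl ℂ h (ball c r) := by
      refine DifferentiableOn.diffContOnCl fun x hx => ?_
      rw [closure_ball _ hr.ne'] at hx
      exact (hh x hx).differentiableAt.differentiableWithinAt
    rw [hFeq w hw η (hS hη), ← hd.two_pi_i_inv_smul_circleIntegral_sub_inv_smul hw]
    congr 1
    refine circleIntegral.integral_congr hr.le fun ζ hζ => ?_
    have : ContinuousAt (fun ζ => A (ζ, η)) ζ :=
      (hA ζ hζ η (ball_subset_closedBall (hS hη))).along_fst.continuousAt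
    simp only [hval ζ (sphere_subset_closedBall hζ) this]
  have hb : ∀ᶠ w in 𝓝[≠] z, w ∈ ball c r := mem_nhdsWithin_of_mem_nhds (isOpen_ball.mem_nhds hz)
  filter_upwards [hb, hhA z (ball_subset_closedBall hz)] with w hw hw'
  rw [key w hw, hw']

/-! ### Analytic germs in two variables -/

/-- A nonzero analytic germ stays nonzero as a germ at all nearby points, so that its zero set is
nowhere dense near `p`. -/
theorem eventually_not_eventually_zero {c : ℂ × ℂ → ℂ} {p : ℂ × ℂ} (hc : AnalyticAt ℂ c p)
    (h0 : ¬ ∀ᶠ q in 𝓝 p, c q = 0) : ∀ᶠ p' in 𝓝 p, ¬ ∀ᶠ q in 𝓝 p', c q = 0 := by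
  obtain ⟨ε, hε, hb⟩ := Metric.eventually_nhds_iff_ball.1 hc.eventually_analyticAt
  filter_upwards [Metric.ball_mem_nhds p hε] with p' hp' hz
  have hon : AnalyticOnNhd ℂ c (Metric.ball p ε) := hb
  have := hon.eqOn_zero_of_preconnected_of_eventuallyEq_zero
    (convex_ball p ε).isPreconnected hp' hz
  exact h0 (by filter_upwards [Metric.ball_mem_nhds p hε] with q hq using this hq)

theorem not_eventually_mul_eq_zero {a b : ℂ × ℂ → ℂ} {p : ℂ × ℂ} (ha : AnalyticAt ℂ a p)
    (hb : AnalyticAt ℂ b p) (ha0 : ¬ ∀ᶠ q in 𝓝 p, a q = 0) (hb0 : ¬ ∀ᶠ q in 𝓝 p, b q = 0) :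
    ¬ ∀ᶠ q in 𝓝 p, a q * b q = 0 := by
  intro h
  refine ha0 ?_
  filter_upwards [eventually_not_eventually_zero hb hb0, h.eventually_nhds,
    ha.eventually_analyticAt] with q hq hq' haq
  by_contra hne
  refine hq ?_
  filter_upwards [hq', haq.continuousAt.eventually_ne hne] with q' h1 h2
  exact (mul_eq_zero.1 h1).resolve_left h2

/-- Analytic germs that agree outside a thin analytic set are equal. -/
theorem eventuallyEq_of_eventually_ne_zero {f g c : ℂ × ℂ → ℂ} {p : ℂ × ℂ}
    (hf : AnalyticAt ℂ f p) (hg : AnalyticAt ℂ g p) (hc : AnalyticAt ℂ c p)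
    (h0 : ¬ ∀ᶠ q in 𝓝 p, c q = 0) (h : ∀ᶠ q in 𝓝 p, c q ≠ 0 → f q = g q) : f =ᶠ[𝓝 p] g := by
  filter_upwards [eventually_not_eventually_zero hc h0, h.eventually_nhds,
    hf.eventually_analyticAt, hg.eventually_analyticAt] with q hq hq' hfq hgq
  have hfr : ∃ᶠ q' in 𝓝 q, f q' = g q' :=
    ((not_eventually.1 hq).and_eventually hq').mono fun q' h => h.2 h.1
  exact tendsto_nhds_unique_of_frequently_eq hfq.continuousAt hgq.continuousAt hfr

theorem not_eventually_zero_of_slice {b : ℂ × ℂ → ℂ} {p : ℂ × ℂ}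
    (h : ¬ ∀ᶠ z in 𝓝 p.1, b (z, p.2) = 0) : ¬ ∀ᶠ q in 𝓝 p, b q = 0 := fun h' => by
  have : Tendsto (fun z => (z, p.2)) (𝓝 p.1) (𝓝 p) :=
    Continuous.tendsto' (by fun_prop) _ _ rfl
  exact h (this.eventually h')

theorem AnalyticAt.eventually_ne_zero_of_not_eventually_zero {f : ℂ → ℂ} {z : ℂ}
    (hf : AnalyticAt ℂ f z) (h : ¬ ∀ᶠ w in 𝓝 z, f w = 0) : ∀ᶠ w in 𝓝[≠] z, f w ≠ 0 :=
  hf.eventually_eq_zero_or_eventually_ne_zero.resolve_left h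

theorem tendsto_prodMk_left_nhdsNE (p : ℂ × ℂ) :
    Tendsto (fun z => (z, p.2)) (𝓝[≠] p.1) (𝓝 p) :=
  (Continuous.tendsto' (by fun_prop) _ _ rfl).mono_left nhdsWithin_le_nhds

theorem not_eventually_sub_pow_eq_zero (p : ℂ × ℂ) (k : ℕ) :
    ¬ ∀ᶠ q in 𝓝 p, (q.2 - p.2) ^ k = 0 := fun h => by
  have hsl : Tendsto (fun w => (p.1, w)) (𝓝[≠] p.2) (𝓝 p) :=
    (Continuous.tendsto' (by fun_prop) _ _ rfl).mono_left nhdsWithin_le_nhds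
  obtain ⟨w, h2, h3⟩ := ((hsl.eventually h).and eventually_mem_nhdsWithin).exists
  exact h3 (sub_eq_zero.1 (eq_zero_of_pow_eq_zero h2))

open Metric in
/-- A nonzero analytic germ at `p` is a power of `δ - p.2` times an analytic germ that does not
vanish identically on the line `δ = p.2`.  The exponent is the smallest order at `p.2` of a slice
`g(z, ·)` with `z` near `p.1`; dividing by that power leaves removable singularities in every slice,
and `exists_analytic_extension`, with the two variables exchanged, makes the quotient jointly
analytic. -/
theorem exists_eq_pow_mul {g : ℂ × ℂ → ℂ} {p : ℂ × ℂ} (hg : AnalyticAt ℂ g p)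
    (h0 : ¬ ∀ᶠ q in 𝓝 p, g q = 0) :
    ∃ (n : ℕ) (g₁ : ℂ × ℂ → ℂ), AnalyticAt ℂ g₁ p ∧ (¬ ∀ᶠ z in 𝓝 p.1, g₁ (z, p.2) = 0) ∧
      ∀ᶠ q in 𝓝 p, g q = (q.2 - p.2) ^ n * g₁ q := by
  obtain ⟨z₀, d⟩ := p
  obtain ⟨ε, hε, hb⟩ := Metric.eventually_nhds_iff_ball.1 hg.eventually_analyticAt
  have hana : ∀ z ∈ ball z₀ ε, ∀ η ∈ ball d ε, AnalyticAt ℂ g (z, η) := fun z hz η hη =>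
    hb _ (by rw [← ball_prod_same]; exact ⟨hz, hη⟩)
  set r := ε / 2 with hr
  have hr0 : 0 < r := by positivity
  have hcl : ∀ c : ℂ, closedBall c r ⊆ ball c ε := fun c => closedBall_subset_ball (by linarith)
  have hbs : ∀ c : ℂ, ball c r ⊆ ball c ε := fun c => ball_subset_closedBall.trans (hcl c)
  let o : ℂ → ℕ∞ := fun z => analyticOrderAt (fun η => g (z, η)) d
  have hdm : d ∈ ball d r := mem_ball_self hr0
  have hex : ∃ n : ℕ, ∃ z ∈ ball z₀ r, o z = n := by
    by_contra! hno
    refine h0 ?_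
    have hU : ball z₀ r ×ˢ ball d r ∈ 𝓝 (z₀, d) :=
      (isOpen_ball.prod isOpen_ball).mem_nhds ⟨mem_ball_self hr0, hdm⟩
    filter_upwards [hU] with q hq
    have ht : o q.1 = ⊤ := by
      by_contra hne
      exact hno _ q.1 hq.1 (ENat.natCast_toNat hne).symm
    have hon : AnalyticOnNhd ℂ (fun η => g (q.1, η)) (ball d ε) := fun η hη =>
      (hana q.1 (hbs _ hq.1) η hη).along_snd
    exact hon.eqOn_zero_of_preconnected_of_eventuallyEq_zero (convex_ball d ε).isPreconnected
      (hbs _ hdm) (analyticOrderAt_eq_top.1 ht) (hbs _ hq.2)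
  classical
  set n := Nat.find hex with hn
  obtain ⟨z₁, hz₁, hoz₁⟩ := Nat.find_spec hex
  have hmin : ∀ z ∈ ball z₀ r, (n : ℕ∞) ≤ o z := fun z hz => by
    by_contra! hlt
    have hne : o z ≠ ⊤ := ne_top_of_lt hlt
    rw [← ENat.natCast_toNat hne, Nat.cast_lt] at hlt
    exact Nat.find_min hex hlt ⟨z, hz, (ENat.natCast_toNat hne).symm⟩
  have hpow : ∀ x : ℂ, AnalyticAt ℂ (fun η : ℂ => (η - d) ^ n) x := fun x => by fun_prop
  obtain ⟨F, hF, hFeq⟩ := exists_analytic_extension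
    (A := fun q => g (q.2, q.1) / (q.1 - d) ^ n) (c := d) (d := z₀) hr0 hr0 (S := ball z₀ r)
    subset_rfl
    (fun η hη z hz => by
      have hne : η - d ≠ 0 := sub_ne_zero.2 (ne_of_mem_sphere hη hr0.ne')
      refine AnalyticAt.div ?_ ((analyticAt_fst.sub analyticAt_const).pow n) (pow_ne_zero _ hne)
      exact (hana z (hcl _ hz) η (hcl _ (sphere_subset_closedBall hη))).comp₂
        analyticAt_snd analyticAt_fst)
    (fun z hz η hη => ((hana z (hbs _ hz) η (hcl _ hη)).along_snd.meromorphicAt).div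
      (hpow η).meromorphicAt)
    (fun z hz η hη => by
      have hgm := (hana z (hbs _ hz) η (hcl _ hη)).along_snd
      by_cases hηd : η = d
      · subst hηd
        have h1 : meromorphicOrderAt (fun ζ => g (z, ζ) / (ζ - η) ^ n) η
            = meromorphicOrderAt (fun ζ => g (z, ζ)) η - n := by
          rw [fun_meromorphicOrderAt_div hgm.meromorphicAt (hpow η).meromorphicAt,
            fun_meromorphicOrderAt_pow_id_sub_const]
        simp only []
        rw [h1, hgm.meromorphicOrderAt_eq]
        have := hmin z hz
        change (n : ℕ∞) ≤ analyticOrderAt (fun ζ => g (z, ζ)) η at this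
        generalize analyticOrderAt (fun ζ => g (z, ζ)) η = m at this
        induction m using ENat.recTopCoe with
        | top => simp
        | coe m =>
          have : n ≤ m := by exact_mod_cast this
          have h2 : (0 : WithTop ℤ) ≤ (((m : ℤ) - (n : ℤ) : ℤ) : WithTop ℤ) := by
            exact_mod_cast (by omega : (0 : ℤ) ≤ m - n)
          simpa using h2
      · exact (hgm.div (hpow η) (pow_ne_zero _ (sub_ne_zero.2 hηd))).meromorphicOrderAt_nonneg)
  have hFg : ∀ z ∈ ball z₀ r, ∀ η ∈ ball d r, g (z, η) = (η - d) ^ n * F (η, z) := by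
    intro z hz η hη
    have hFa : AnalyticAt ℂ (fun η => (η - d) ^ n * F (η, z)) η :=
      (hpow η).mul (hF (η, z) ⟨hη, hz⟩).along_fst
    have hga := (hana z (hbs _ hz) η (hbs _ hη)).along_snd
    have : (fun η => g (z, η)) =ᶠ[𝓝[≠] η] fun η => (η - d) ^ n * F (η, z) := by
      have hne : ∀ᶠ w in 𝓝[≠] η, w ≠ d := by
        by_cases hηd : η = d
        · rw [hηd]; exact eventually_mem_nhdsWithin
        · exact (eventually_ne_nhds hηd).filter_mono nhdsWithin_le_nhds
      filter_upwards [hFeq z hz η hη, hne] with w hw hwd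
      rw [hw]
      field_simp [sub_ne_zero.2 hwd]
    exact ((hga.continuousAt.eventuallyEq_nhds_iff_eventuallyEq_nhdsNE hFa.continuousAt).1
      this).eq_of_nhds
  refine ⟨n, fun q => F (q.2, q.1), ?_, ?_, ?_⟩
  · exact (hF (d, z₀) ⟨hdm, mem_ball_self hr0⟩).comp₂ analyticAt_snd analyticAt_fst
  · intro hz
    have hon : AnalyticOnNhd ℂ (fun z => F (d, z)) (ball z₀ r) := fun z hz =>
      (hF (d, z) ⟨hdm, hz⟩).along_snd
    have h1 : F (d, z₁) = 0 := hon.eqOn_zero_of_preconnected_of_eventuallyEq_zero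
      (convex_ball z₀ r).isPreconnected (mem_ball_self hr0) hz hz₁
    have hFa : AnalyticAt ℂ (fun η => F (η, z₁)) d := (hF (d, z₁) ⟨hdm, hz₁⟩).along_fst
    have h2 : analyticOrderAt (fun η => F (η, z₁)) d ≠ 0 := by
      rw [analyticOrderAt_ne_zero]; exact ⟨hFa, h1⟩
    have h3 : o z₁ = n + analyticOrderAt (fun η => F (η, z₁)) d := by
      have : (fun η => g (z₁, η)) =ᶠ[𝓝 d] (fun η => (η - d) ^ n) * fun η => F (η, z₁) := by
        filter_upwards [isOpen_ball.mem_nhds hdm] with η hη using hFg z₁ hz₁ η hη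
      simp only [o]
      rw [analyticOrderAt_congr this, analyticOrderAt_mul (hpow d) hFa]
      congr 1
      exact analyticOrderAt_centeredMonomial
    rw [hoz₁, ← hn] at h3
    have h4 : (n : ℕ∞) + 0 = n + analyticOrderAt (fun η => F (η, z₁)) d := by simpa using h3
    exact h2 (WithTop.add_left_cancel (ENat.natCast_ne_top n) h4).symm
  · have hU : ball z₀ r ×ˢ ball d r ∈ 𝓝 (z₀, d) :=
      (isOpen_ball.prod isOpen_ball).mem_nhds ⟨mem_ball_self hr0, hdm⟩
    filter_upwards [hU] with q hq using hFg q.1 hq.1 q.2 hq.2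

/-! ### Orders of vanishing in one variable -/

/-- The residue of the logarithmic derivative is the order. -/
theorem tendsto_sub_mul_logDeriv {M : ℂ → ℂ} {z₀ : ℂ} (hM : MeromorphicAt M z₀)
    {n : ℤ} (hn : meromorphicOrderAt M z₀ = n) :
    Tendsto (fun z => (z - z₀) * logDeriv M z) (𝓝[≠] z₀) (𝓝 n) := by
  obtain ⟨g, hg, hg0, hMg⟩ := (meromorphicOrderAt_eq_int_iff hM).1 hn
  have hlim : Tendsto (fun z => n + (z - z₀) * (deriv g z / g z)) (𝓝[≠] z₀) (𝓝 n) := by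
    have hc : ContinuousAt (fun z => n + (z - z₀) * (deriv g z / g z)) z₀ :=
      continuousAt_const.add ((continuousAt_id.sub continuousAt_const).mul
        (hg.deriv.continuousAt.div hg.continuousAt hg0))
    have := hc.tendsto
    simp only [sub_self, zero_mul, add_zero] at this
    exact this.mono_left nhdsWithin_le_nhds
  refine hlim.congr' ?_
  filter_upwards [hMg, EventuallyEq.nhdsNE_deriv hMg, eventually_mem_nhdsWithin,
    (hg.eventually_analyticAt.and (hg.continuousAt.eventually_ne hg0)).filter_mono
      nhdsWithin_le_nhds] with z h1 h2 h3 h4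
  have hz : z - z₀ ≠ 0 := sub_ne_zero.2 h3
  have hp : HasDerivAt (fun z => (z - z₀) ^ n) (n * (z - z₀) ^ (n - 1)) z :=
    (hasDerivAt_zpow n _ (Or.inl hz)).comp_sub_const z z₀
  have hd : HasDerivAt (fun z => (z - z₀) ^ n • g z)
      (n * (z - z₀) ^ (n - 1) * g z + (z - z₀) ^ n * deriv g z) z :=
    hp.fun_mul h4.1.differentiableAt.hasDerivAt
  rw [logDeriv_apply, h2, hd.deriv, h1, zpow_sub_one₀ hz, smul_eq_mul]
  have h5 := h4.2
  have h6 := zpow_ne_zero n hz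
  field_simp

theorem meromorphicOrderAt_add_const {F : ℂ → ℂ} {z₀ : ℂ} (c : ℂ)
    (hF : meromorphicOrderAt F z₀ < 0) :
    meromorphicOrderAt (fun z => F z + c) z₀ = meromorphicOrderAt F z₀ :=
  meromorphicOrderAt_add_eq_left_of_lt (MeromorphicAt.const c z₀)
    (hF.trans_le (analyticAt_const (v := c)).meromorphicOrderAt_nonneg)

/-- For `δ ≠ ±2` the cubic `x³ + δx² + x` has no multiple root. -/
theorem cubic_separable {δ x : ℂ} (hδ : δ ^ 2 ≠ 4) (h : x ^ 3 + δ * x ^ 2 + x = 0) :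
    3 * x ^ 2 + 2 * δ * x + 1 ≠ 0 := by
  intro h'
  have hx : x ≠ 0 := by rintro rfl; simp at h'
  have h1 : x ^ 2 + δ * x + 1 = 0 := by
    apply mul_left_cancel₀ hx; linear_combination h
  have h2 : 2 * x + δ = 0 := by
    apply mul_left_cancel₀ hx; linear_combination h' - h1
  exact hδ (by linear_combination (2 * x + δ) * h2 - 4 * h1)

/-- If `φ Y² = X³ + δX² + X` with `δ ≠ ±2` and `φ` analytic, then `X' / Y` has no pole.  This is
the holomorphy of the pullback of the invariant differential of an elliptic curve.  From
`2 ord Y ≤ ord (X³ + δX² + X)` one finds `2 ord (X' / Y) ≥ -1`, whence `ord (X' / Y) ≥ 0`: at a pole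
of `X` of order `k` the left side is at least `k - 2`, and at a zero of order `m ≥ 1` of the cubic,
where `ord X' = m - 1` because the roots are simple, it is at least `m - 2`. -/
theorem meromorphicOrderAt_deriv_div_nonneg {X Y φ : ℂ → ℂ} {z₀ δ : ℂ} (hX : MeromorphicAt X z₀)
    (hY : MeromorphicAt Y z₀) (hφ : AnalyticAt ℂ φ z₀) (hφ0 : meromorphicOrderAt φ z₀ ≠ ⊤)
    (hY0 : meromorphicOrderAt Y z₀ ≠ ⊤) (hδ : δ ^ 2 ≠ 4)
    (hE : (fun z => φ z * Y z ^ 2) =ᶠ[𝓝[≠] z₀] fun z => X z ^ 3 + δ * X z ^ 2 + X z) :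
    0 ≤ meromorphicOrderAt (fun z => deriv X z / Y z) z₀ := by
  obtain ⟨e, he⟩ := WithTop.ne_top_iff_exists.1 hφ0
  obtain ⟨y, hy⟩ := WithTop.ne_top_iff_exists.1 hY0
  have he0 : 0 ≤ e := by
    have := hφ.meromorphicOrderAt_nonneg
    rw [← he] at this
    exact_mod_cast this
  have hL : meromorphicOrderAt (fun z => X z ^ 3 + δ * X z ^ 2 + X z) z₀
      = ((e + 2 * y : ℤ) : WithTop ℤ) := by
    rw [← meromorphicOrderAt_congr hE, fun_meromorphicOrderAt_mul hφ.meromorphicAt (hY.fun_pow 2),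
      fun_meromorphicOrderAt_pow hY, ← he, ← hy]
    push_cast
    rfl
  rw [fun_meromorphicOrderAt_div hX.deriv hY, ← hy]
  suffices h : ∀ d : ℤ, meromorphicOrderAt (deriv X) z₀ = d → 0 ≤ d - y by
    generalize hd : meromorphicOrderAt (deriv X) z₀ = d
    cases d with
    | top => simp
    | coe d => exact_mod_cast h d hd
  intro d hd
  rcases lt_or_ge (meromorphicOrderAt X z₀) 0 with hneg | hpos
  · obtain ⟨n, hn⟩ := WithTop.ne_top_iff_exists.1 (ne_top_of_lt hneg)
    have hn0 : n < 0 := by rw [← hn] at hneg; exact_mod_cast hneg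
    have h1 : meromorphicOrderAt (fun z => X z + δ) z₀ = n :=
      (meromorphicOrderAt_add_const δ hneg).trans hn.symm
    have h2 : meromorphicOrderAt (fun z => X z * (X z + δ)) z₀ = ((n + n : ℤ) : WithTop ℤ) := by
      rw [fun_meromorphicOrderAt_mul hX (hX.fun_add (MeromorphicAt.const δ z₀)), h1, ← hn]
      push_cast; rfl
    have h3 : meromorphicOrderAt (fun z => X z * (X z + δ) + 1) z₀ = ((n + n : ℤ) : WithTop ℤ) := by
      rw [meromorphicOrderAt_add_const, h2]
      rw [h2]; exact_mod_cast (by omega : n + n < 0)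
    have h4 : (fun z => X z ^ 3 + δ * X z ^ 2 + X z) = fun z => X z * (X z * (X z + δ) + 1) := by
      ext z; ring
    rw [h4, fun_meromorphicOrderAt_mul hX ((hX.fun_mul
      (hX.fun_add (MeromorphicAt.const δ z₀))).fun_add (MeromorphicAt.const 1 z₀)), h3, ← hn] at hL
    have h5 : n + (n + n) = e + 2 * y := by exact_mod_cast hL
    have h6 := meromorphicOrderAt_deriv_eq_sub_one (n := n) (by exact_mod_cast hn0.ne) hn.symm
    rw [hd] at h6
    have h7 : d = n - 1 := by exact_mod_cast h6
    omega
  · obtain ⟨X₁, hX₁, hXX₁⟩ := hX.meromorphicOrderAt_nonneg_iff.1 hpos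
    let P : ℂ → ℂ := fun z => X₁ z ^ 3 + δ * X₁ z ^ 2 + X₁ z
    have hP : AnalyticAt ℂ P z₀ := by fun_prop
    have hPo : meromorphicOrderAt P z₀ = ((e + 2 * y : ℤ) : WithTop ℤ) := by
      rw [← hL]
      refine meromorphicOrderAt_congr ?_
      filter_upwards [hXX₁] with z hz
      simp only [P, hz]
    have hd₁ : meromorphicOrderAt (deriv X₁) z₀ = d := by
      rw [← hd]; exact meromorphicOrderAt_congr hXX₁.nhdsNE_deriv.symm
    have hd0 : 0 ≤ d := by
      have := hX₁.deriv.meromorphicOrderAt_nonneg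
      rw [hd₁] at this; exact_mod_cast this
    have hm0 : 0 ≤ e + 2 * y := by
      have := hP.meromorphicOrderAt_nonneg
      rw [hPo] at this; exact_mod_cast this
    by_cases hm : e + 2 * y = 0
    · omega
    · have h1 : meromorphicOrderAt (deriv P) z₀ = ((e + 2 * y - 1 : ℤ) : WithTop ℤ) :=
        meromorphicOrderAt_deriv_eq_sub_one (by exact_mod_cast hm) hPo
      have hP0 : P z₀ = 0 := by
        by_contra hne
        have h0 : meromorphicOrderAt P z₀ = 0 := by
          rw [hP.meromorphicOrderAt_eq, hP.analyticOrderAt_eq_zero.2 hne]; rfl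
        rw [hPo] at h0
        exact hm (by exact_mod_cast h0)
      have h2 : deriv P =ᶠ[𝓝[≠] z₀]
          (fun z => 3 * X₁ z ^ 2 + 2 * δ * X₁ z + 1) * deriv X₁ := by
        refine Filter.Eventually.filter_mono nhdsWithin_le_nhds ?_
        filter_upwards [hX₁.eventually_analyticAt] with z hz
        have hx := hz.differentiableAt.hasDerivAt
        have := ((hx.pow 3).add ((hx.pow 2).const_mul δ)).add hx
        have h3 : HasDerivAt P _ z := this
        rw [h3.deriv, Pi.mul_apply]
        push_cast
        ring
      have hg : AnalyticAt ℂ (fun z => 3 * X₁ z ^ 2 + 2 * δ * X₁ z + 1) z₀ := by fun_prop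
      rw [meromorphicOrderAt_congr h2, meromorphicOrderAt_mul_of_ne_zero hg
        (cubic_separable hδ hP0), hd₁] at h1
      have h4 : d = e + 2 * y - 1 := by exact_mod_cast h1
      omega

/-- The degenerate fibre.  If `z(z-1)² Y² = X(X-1)²` and `X' / Y` extends analytically to `z = 1`,
its value there is an integer.  With `u = √z` and `T = u(z-1)Y/(X-1)` one has `X = T²` and
`X' / Y = u (z-1) (T'/(T-1) - T'/(T+1))`, so the value is the order of `T - 1` minus that of
`T + 1`. -/
theorem exists_int_eq_of_nodal {X Y α : ℂ → ℂ} (hX : MeromorphicAt X 1) (hY : MeromorphicAt Y 1)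
    (hα : AnalyticAt ℂ α 1) (hY0 : ∀ᶠ z in 𝓝[≠] (1 : ℂ), Y z ≠ 0)
    (hE : ∀ᶠ z in 𝓝[≠] (1 : ℂ), z * (z - 1) ^ 2 * Y z ^ 2 = X z * (X z - 1) ^ 2)
    (hαY : ∀ᶠ z in 𝓝[≠] (1 : ℂ), α z * Y z = deriv X z) : ∃ n : ℤ, α 1 = n := by
  -- The branch of `√z` near `z = 1`.
  let u : ℂ → ℂ := fun z => Complex.exp (Complex.log z / 2)
  have hu : AnalyticAt ℂ u 1 :=
    ((analyticAt_clog (by simp)).div_const).cexp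
  have hu2 : ∀ z : ℂ, z ≠ 0 → u z ^ 2 = z := fun z hz => by
    rw [← Complex.exp_nat_mul]
    rw [show ((2 : ℕ) : ℂ) * (Complex.log z / 2) = Complex.log z by push_cast; ring,
      Complex.exp_log hz]
  have hu1 : u 1 = 1 := by simp [u]
  let T : ℂ → ℂ := fun z => u z * (z - 1) * Y z / (X z - 1)
  have hT : MeromorphicAt T 1 := by
    have := hu.meromorphicAt
    fun_prop
  have hz0 : ∀ᶠ z in 𝓝[≠] (1 : ℂ), z ≠ 0 :=
    (eventually_ne_nhds one_ne_zero).filter_mono nhdsWithin_le_nhds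
  have hz1 : ∀ᶠ z in 𝓝[≠] (1 : ℂ), z ≠ 1 := eventually_mem_nhdsWithin
  have hX1 : ∀ᶠ z in 𝓝[≠] (1 : ℂ), X z ≠ 0 ∧ X z - 1 ≠ 0 := by
    filter_upwards [hz0, hz1, hY0, hE] with z h0 h1 hy he
    have : z * (z - 1) ^ 2 * Y z ^ 2 ≠ 0 := by
      have := sub_ne_zero.2 h1
      positivity
    rw [he] at this
    simpa using this
  have hTX : ∀ᶠ z in 𝓝[≠] (1 : ℂ), X z = T z ^ 2 := by
    filter_upwards [hz0, hX1, hE] with z h0 hx he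
    have := hx.2
    simp only [T, div_pow, mul_pow, hu2 z h0]
    rw [he]
    field_simp
  have hder : ∀ᶠ z in 𝓝[≠] (1 : ℂ), deriv X z = 2 * T z * deriv T z := by
    filter_upwards [EventuallyEq.nhdsNE_deriv hTX, hT.eventually_analyticAt] with z h1 h2
    rw [h1, (h2.differentiableAt.hasDerivAt.fun_pow 2).deriv]
    push_cast
    ring
  have hord : ∀ c : ℂ, c ^ 2 = 1 → ∃ n : ℤ,
      meromorphicOrderAt (fun z => T z - c) 1 = n := fun c hc => by
    have : meromorphicOrderAt (fun z => T z - c) 1 ≠ ⊤ := by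
      rw [meromorphicOrderAt_ne_top_iff_eventually_ne_zero (by fun_prop)]
      filter_upwards [hTX, hX1] with z h1 h2 h3
      rw [h1, sub_eq_zero.1 h3, hc] at h2
      exact h2.2 (sub_self 1)
    exact (WithTop.ne_top_iff_exists.1 this).imp fun _ h => h.symm
  obtain ⟨n₁, hn₁⟩ := hord 1 (by norm_num)
  obtain ⟨n₂, hn₂⟩ := hord (-1) (by norm_num)
  have hl₁ := tendsto_sub_mul_logDeriv (by fun_prop) hn₁
  have hl₂ := tendsto_sub_mul_logDeriv (by fun_prop) hn₂
  have hul : Tendsto u (𝓝[≠] 1) (𝓝 1) := by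
    have := hu.continuousAt.tendsto.mono_left (nhdsWithin_le_nhds (s := {1}ᶜ))
    rwa [hu1] at this
  have hlim := hul.mul (hl₁.sub hl₂)
  refine ⟨n₁ - n₂, ?_⟩
  have hα' := hα.continuousAt.tendsto.mono_left (nhdsWithin_le_nhds (s := {1}ᶜ))
  refine (tendsto_nhds_unique hα' (hlim.congr' ?_)).trans (by push_cast; ring)
  filter_upwards [hz0, hz1, hX1, hTX, hder, hαY, hY0] with z h0 h1 hx htx hd ha hy
  have hz : z - 1 ≠ 0 := sub_ne_zero.2 h1
  have hu0 : u z ≠ 0 := Complex.exp_ne_zero _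
  have hT0 : T z ≠ 0 := by
    intro h; rw [h] at htx; exact hx.1 (by simpa using htx)
  have hfac : X z - 1 = (T z - 1) * (T z + 1) := by rw [htx]; ring
  have hT1 : T z - 1 ≠ 0 := fun h => hx.2 (by rw [hfac, h, zero_mul])
  have hT2 : T z + 1 ≠ 0 := fun h => hx.2 (by rw [hfac, h, mul_zero])
  have hYT : u z * (z - 1) * Y z = T z * ((T z - 1) * (T z + 1)) := by
    rw [← hfac]
    simp only [T]
    field_simp [hx.2]
  clear_value T u
  rw [logDeriv_apply, logDeriv_apply, deriv_sub_const, deriv_sub_const, sub_neg_eq_add]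
  apply mul_right_cancel₀ hy
  rw [ha, hd]
  field_simp
  linear_combination (2 * deriv T z) * hYT

/-! ### The Manin-Denef equation near `(1, -2)` -/

theorem MeroEqAt.trans {f g h : ℂ × ℂ → ℂ} {p : ℂ × ℂ} (hfg : MeroEqAt f g p)
    (hgh : MeroEqAt g h p) : MeroEqAt f h p := by
  obtain ⟨c₁, hc₁, h₁, e₁⟩ := hfg
  obtain ⟨c₂, hc₂, h₂, e₂⟩ := hgh
  refine ⟨fun q => c₁ q * c₂ q, hc₁.mul hc₂, not_eventually_mul_eq_zero hc₁ hc₂ h₁ h₂, ?_⟩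
  filter_upwards [e₁, e₂] with q a b hne
  rw [a (left_ne_zero_of_mul hne), b (right_ne_zero_of_mul hne)]

theorem AnalyticAt.partialZ {g : ℂ × ℂ → ℂ} {p : ℂ × ℂ} (hg : AnalyticAt ℂ g p) :
    AnalyticAt ℂ (_root_.partialZ g) p := by
  have h : AnalyticAt ℂ (fun q => fderiv ℂ g q (1, 0)) p :=
    ((ContinuousLinearMap.apply ℂ ℂ ((1, 0) : ℂ × ℂ)).analyticAt _).comp hg.fderiv
  refine h.congr ?_
  filter_upwards [hg.eventually_analyticAt] with q hq
  have h1 : HasFDerivAt g (fderiv ℂ g q) ((fun t : ℂ => (t, q.2)) q.1) :=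
    hq.differentiableAt.hasFDerivAt
  exact (h1.comp_hasDerivAt q.1 ((hasDerivAt_id q.1).prodMk (hasDerivAt_const q.1 q.2))).deriv.symm

theorem deriv_slice_div {a b : ℂ × ℂ → ℂ} {z δ : ℂ} (ha : AnalyticAt ℂ a (z, δ))
    (hb : AnalyticAt ℂ b (z, δ)) (hb0 : b (z, δ) ≠ 0) :
    deriv (fun t => a (t, δ) / b (t, δ)) z =
      (partialZ a (z, δ) * b (z, δ) - a (z, δ) * partialZ b (z, δ)) / b (z, δ) ^ 2 :=
  deriv_fun_div ha.along_fst.differentiableAt hb.along_fst.differentiableAt hb0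

/-- For `x = a / b` and `y = s / t` the quotient `x_z / y` is given by the quotient rule: where the
exceptional functions do not vanish, `x` agrees with `a / b` on a whole neighbourhood, so that the
derivative of the representative is the expected one. -/
theorem meroEqAt_quotA {x y a b s t : ℂ × ℂ → ℂ} {p : ℂ × ℂ} (ha : AnalyticAt ℂ a p)
    (hb : AnalyticAt ℂ b p)
    (hb0 : ¬ ∀ᶠ q in 𝓝 p, b q = 0) (hx : MeroEqAt x (fun q => a q / b q) p)
    (hy : MeroEqAt y (fun q => s q / t q) p) :
    MeroEqAt (quotA x y) (fun q =>
      (partialZ a q * b q - a q * partialZ b q) * t q / (b q ^ 2 * s q)) p := by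
  obtain ⟨c₁, hc₁, h₁, e₁⟩ := hx
  obtain ⟨c₂, hc₂, h₂, e₂⟩ := hy
  refine ⟨fun q => c₁ q * b q * c₂ q, (hc₁.mul hb).mul hc₂, not_eventually_mul_eq_zero (hc₁.mul hb)
    hc₂ (not_eventually_mul_eq_zero hc₁ hb h₁ hb0) h₂, ?_⟩
  filter_upwards [e₁.eventually_nhds, e₂, ha.eventually_analyticAt, hb.eventually_analyticAt,
    hc₁.eventually_analyticAt] with q h1 h2 haq hbq hcq hne
  obtain ⟨hne, hc2⟩ := mul_ne_zero_iff.1 hne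
  obtain ⟨hc1, hbne⟩ := mul_ne_zero_iff.1 hne
  have hxq : x =ᶠ[𝓝 q] fun q => a q / b q := by
    filter_upwards [h1, hcq.continuousAt.eventually_ne hc1] with q' h h' using h h'
  have hsl : Tendsto (fun z => (z, q.2)) (𝓝 q.1) (𝓝 q) :=
    Continuous.tendsto' (by fun_prop) _ _ rfl
  have hd : partialZ x q = (partialZ a q * b q - a q * partialZ b q) / b q ^ 2 :=
    (EventuallyEq.deriv_eq (hxq.comp_tendsto hsl)).trans (deriv_slice_div haq hbq hbne)
  rw [quotA, hd, h2 hc2, div_div_div_eq]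

/-- The Manin-Denef equation with denominators cleared, as an identity of analytic germs. -/
theorem maninDenef_numerators {x y a b s t : ℂ × ℂ → ℂ} {p : ℂ × ℂ} (ha : AnalyticAt ℂ a p)
    (hb : AnalyticAt ℂ b p) (hs : AnalyticAt ℂ s p) (ht : AnalyticAt ℂ t p)
    (hb0 : ¬ ∀ᶠ q in 𝓝 p, b q = 0) (ht0 : ¬ ∀ᶠ q in 𝓝 p, t q = 0)
    (hx : MeroEqAt x (fun q => a q / b q) p) (hy : MeroEqAt y (fun q => s q / t q) p)
    (hE : MeroEqAt (fun q => (q.1 ^ 3 + q.2 * q.1 ^ 2 + q.1) * y q ^ 2)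
      (fun q => x q ^ 3 + q.2 * x q ^ 2 + x q) p) :
    ∀ᶠ q in 𝓝 p, (q.1 ^ 3 + q.2 * q.1 ^ 2 + q.1) * s q ^ 2 * b q ^ 3 =
      t q ^ 2 * (a q ^ 3 + q.2 * a q ^ 2 * b q + a q * b q ^ 2) := by
  obtain ⟨c₁, hc₁, h₁, e₁⟩ := hx
  obtain ⟨c₂, hc₂, h₂, e₂⟩ := hy
  obtain ⟨c₃, hc₃, h₃, e₃⟩ := hE
  have hfst : AnalyticAt ℂ (fun q : ℂ × ℂ => q.1) p := analyticAt_fst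
  have hsnd : AnalyticAt ℂ (fun q : ℂ × ℂ => q.2) p := analyticAt_snd
  refine eventuallyEq_of_eventually_ne_zero (by fun_prop) (by fun_prop)
    (c := fun q => c₁ q * c₂ q * (c₃ q * (b q * t q))) (by fun_prop)
    (not_eventually_mul_eq_zero (by fun_prop) (by fun_prop)
      (not_eventually_mul_eq_zero hc₁ hc₂ h₁ h₂)
      (not_eventually_mul_eq_zero hc₃ (by fun_prop) h₃ (not_eventually_mul_eq_zero hb ht hb0 ht0))) ?_
  filter_upwards [e₁, e₂, e₃] with q h1 h2 h3 hne
  simp only [ne_eq, mul_eq_zero, not_or] at hne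
  obtain ⟨⟨n1, n2⟩, n3, nb, nt⟩ := hne
  have h := h3 n3
  simp only [h1 n1, h2 n2] at h
  field_simp at h
  linear_combination h

/-- A meromorphic germ either has a representation whose denominator is not divisible by `δ - p.2`,
or it has a pole along `δ = p.2`. -/
theorem MeroAt.exists_div {x : ℂ × ℂ → ℂ} {p : ℂ × ℂ} (hx : MeroAt x p) :
    ∃ a b : ℂ × ℂ → ℂ, AnalyticAt ℂ a p ∧ AnalyticAt ℂ b p ∧
      (¬ ∀ᶠ z in 𝓝 p.1, b (z, p.2) = 0) ∧
      (MeroEqAt x (fun q => a q / b q) p ∨ (¬ ∀ᶠ z in 𝓝 p.1, a (z, p.2) = 0) ∧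
        ∃ k : ℕ, k ≠ 0 ∧ MeroEqAt x (fun q => a q / ((q.2 - p.2) ^ k * b q)) p) := by
  obtain ⟨a₀, b₀, ha₀, hb₀, hb₀0, hxe⟩ := hx
  have hdan : AnalyticAt ℂ (fun q : ℂ × ℂ => q.2 - p.2) p := analyticAt_snd.sub analyticAt_const
  have hd0 : ¬ ∀ᶠ q : ℂ × ℂ in 𝓝 p, q.2 - p.2 = 0 := by
    simpa using not_eventually_sub_pow_eq_zero p 1
  -- The zero germ has no order along the line; it is represented by `0 / 1`.
  by_cases ha0 : ∀ᶠ q in 𝓝 p, a₀ q = 0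
  · refine ⟨fun _ => 0, fun _ => 1, analyticAt_const, analyticAt_const,
      fun h => one_ne_zero h.self_of_nhds, Or.inl ?_⟩
    refine hxe.trans ⟨fun _ => 1, analyticAt_const, fun h => one_ne_zero h.self_of_nhds, ?_⟩
    filter_upwards [ha0] with q hq _
    simp [hq]
  obtain ⟨i, a, ha, ha1, hai⟩ := exists_eq_pow_mul ha₀ ha0
  obtain ⟨j, b, hb, hb1, hbj⟩ := exists_eq_pow_mul hb₀ hb₀0
  rcases le_or_gt j i with hij | hij
  · refine ⟨fun q => (q.2 - p.2) ^ (i - j) * a q, b, (hdan.pow _).mul ha, hb, hb1, Or.inl ?_⟩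
    refine hxe.trans ⟨_, hdan, hd0, ?_⟩
    filter_upwards [hai, hbj] with q h1 h2 hne
    obtain ⟨l, rfl⟩ := Nat.exists_eq_add_of_le hij
    rw [h1, h2, Nat.add_sub_cancel_left, pow_add, mul_assoc,
      mul_div_mul_left _ _ (pow_ne_zero j hne)]
  · refine ⟨a, b, ha, hb, hb1, Or.inr ⟨ha1, j - i, by omega, ?_⟩⟩
    refine hxe.trans ⟨_, hdan, hd0, ?_⟩
    filter_upwards [hai, hbj] with q h1 h2 hne
    obtain ⟨l, rfl⟩ := Nat.exists_eq_add_of_le hij.le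
    rw [h1, h2, Nat.add_sub_cancel_left, pow_add, mul_assoc,
      mul_div_mul_left _ _ (pow_ne_zero i hne)]

/-- If `y` has no pole along `δ = p.2`, neither has `x`: otherwise the cubic in `x` would have a pole
there. -/
theorem exists_div_of_maninDenef {x y s t : ℂ × ℂ → ℂ} {p : ℂ × ℂ} (hx : MeroAt x p)
    (hs : AnalyticAt ℂ s p) (ht : AnalyticAt ℂ t p) (ht0 : ¬ ∀ᶠ z in 𝓝 p.1, t (z, p.2) = 0)
    (hy : MeroEqAt y (fun q => s q / t q) p)
    (hE : MeroEqAt (fun q => (q.1 ^ 3 + q.2 * q.1 ^ 2 + q.1) * y q ^ 2)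
      (fun q => x q ^ 3 + q.2 * x q ^ 2 + x q) p) :
    ∃ a b : ℂ × ℂ → ℂ, AnalyticAt ℂ a p ∧ AnalyticAt ℂ b p ∧
      (¬ ∀ᶠ z in 𝓝 p.1, b (z, p.2) = 0) ∧ MeroEqAt x (fun q => a q / b q) p := by
  obtain ⟨a, b, ha, hb, hb0, hab | ⟨ha0, k, hk, hab⟩⟩ := hx.exists_div
  · exact ⟨a, b, ha, hb, hb0, hab⟩
  exfalso
  have hdan : AnalyticAt ℂ (fun q : ℂ × ℂ => q.2 - p.2) p := analyticAt_snd.sub analyticAt_const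
  have hD0 : ¬ ∀ᶠ q in 𝓝 p, (q.2 - p.2) ^ k * b q = 0 :=
    not_eventually_mul_eq_zero (hdan.pow k) hb (not_eventually_sub_pow_eq_zero p k)
      (not_eventually_zero_of_slice hb0)
  have hev := maninDenef_numerators ha ((hdan.pow k).mul hb) hs ht hD0
    (not_eventually_zero_of_slice ht0) hab hy hE
  have h1 := (tendsto_prodMk_left_nhdsNE p).eventually hev
  have hta := ht.along_fst.eventually_ne_zero_of_not_eventually_zero ht0
  have haa := ha.along_fst.eventually_ne_zero_of_not_eventually_zero ha0
  obtain ⟨z, h1, h2, h3⟩ := (h1.and (hta.and haa)).exists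
  have : t (z, p.2) ^ 2 * a (z, p.2) ^ 3 ≠ 0 := mul_ne_zero (pow_ne_zero _ h2) (pow_ne_zero _ h3)
  refine this ?_
  simpa [hk] using h1.symm

/-- On a fibre with `δ ≠ ±2` the quotient `x_z / y`, written through numerators and denominators,
has no pole in `z`.  The points `z₁` and `z₂` witness that the functions involved do not vanish
identically on the slice. -/
theorem meromorphicOrderAt_slice_nonneg {a b s t : ℂ × ℂ → ℂ} {K : Set ℂ} {δ ζ₀ z₁ z₂ : ℂ}
    (hK : IsPreconnected K)
    (ha : ∀ z ∈ K, AnalyticAt ℂ a (z, δ)) (hb : ∀ z ∈ K, AnalyticAt ℂ b (z, δ))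
    (hs : ∀ z ∈ K, AnalyticAt ℂ s (z, δ)) (ht : ∀ z ∈ K, AnalyticAt ℂ t (z, δ))
    (hz₁ : z₁ ∈ K) (hb₁ : b (z₁, δ) ≠ 0) (hs₁ : s (z₁, δ) ≠ 0) (ht₁ : t (z₁, δ) ≠ 0)
    (hz₂ : z₂ ∈ K) (hφ : z₂ ^ 3 + δ * z₂ ^ 2 + z₂ ≠ 0) (hδ : δ ^ 2 ≠ 4)
    (hζ₀ : ζ₀ ∈ K)
    (hE : ∀ᶠ z in 𝓝 ζ₀, (z ^ 3 + δ * z ^ 2 + z) * s (z, δ) ^ 2 * b (z, δ) ^ 3 =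
      t (z, δ) ^ 2 * (a (z, δ) ^ 3 + δ * a (z, δ) ^ 2 * b (z, δ) + a (z, δ) * b (z, δ) ^ 2)) :
    0 ≤ meromorphicOrderAt (fun z => (partialZ a (z, δ) * b (z, δ) - a (z, δ) * partialZ b (z, δ))
      * t (z, δ) / (b (z, δ) ^ 2 * s (z, δ))) ζ₀ := by
  have hne : ∀ {f : ℂ → ℂ} {z : ℂ}, (∀ w ∈ K, AnalyticAt ℂ f w) → z ∈ K → f z ≠ 0 →
      ∀ᶠ w in 𝓝[≠] ζ₀, f w ≠ 0 := fun {f z} hf hz hfz => by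
    refine (hf ζ₀ hζ₀).eventually_ne_zero_of_not_eventually_zero fun h => hfz ?_
    have hon : AnalyticOnNhd ℂ f K := hf
    exact hon.eqOn_zero_of_preconnected_of_eventuallyEq_zero hK hζ₀ h hz
  have hbn := hne (f := fun z => b (z, δ)) (fun w hw => (hb w hw).along_fst) hz₁ hb₁
  have hsn := hne (f := fun z => s (z, δ)) (fun w hw => (hs w hw).along_fst) hz₁ hs₁
  have htn := hne (f := fun z => t (z, δ)) (fun w hw => (ht w hw).along_fst) hz₁ ht₁
  have hφn := hne (f := fun z => z ^ 3 + δ * z ^ 2 + z) (fun w hw => by fun_prop) hz₂ hφ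
  have ham := (ha ζ₀ hζ₀).along_fst.meromorphicAt
  have hbm := (hb ζ₀ hζ₀).along_fst.meromorphicAt
  have hsm := (hs ζ₀ hζ₀).along_fst.meromorphicAt
  have htm := (ht ζ₀ hζ₀).along_fst.meromorphicAt
  have hφa : AnalyticAt ℂ (fun z : ℂ => z ^ 3 + δ * z ^ 2 + z) ζ₀ := by fun_prop
  have key := meromorphicOrderAt_deriv_div_nonneg (ham.fun_div hbm) (hsm.fun_div htm) hφa
    ((meromorphicOrderAt_ne_top_iff_eventually_ne_zero hφa.meromorphicAt).2 hφn)
    ((meromorphicOrderAt_ne_top_iff_eventually_ne_zero (hsm.fun_div htm)).2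
      (by filter_upwards [hsn, htn] with z h1 h2 using div_ne_zero h1 h2)) hδ
    (by
      filter_upwards [hbn, htn, hE.filter_mono nhdsWithin_le_nhds] with z h1 h2 h3
      field_simp
      linear_combination h3)
  refine key.trans_eq (meromorphicOrderAt_congr ?_)
  filter_upwards [hbn, (ha ζ₀ hζ₀).along_fst.eventually_analyticAt.filter_mono nhdsWithin_le_nhds,
    (hb ζ₀ hζ₀).along_fst.eventually_analyticAt.filter_mono nhdsWithin_le_nhds] with z h1 h2 h3
  rw [deriv_fun_div h2.differentiableAt h3.differentiableAt h1, div_div_div_eq]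
  rfl

open Metric in
/-- The quotient `x_z / y` is analytic at `(1, -2)`.  On a small circle `|z - 1| = r` the
denominators have no zero for `δ` near `-2`, and on each fibre `δ ≠ -2` there are no poles inside
the circle, so the extension principle applies with the fibre `δ = -2` left out of `S`. -/
theorem exists_analytic_quotient {a b s t : ℂ × ℂ → ℂ}
    (ha : AnalyticAt ℂ a (1, -2)) (hb : AnalyticAt ℂ b (1, -2)) (hs : AnalyticAt ℂ s (1, -2))
    (ht : AnalyticAt ℂ t (1, -2)) (hb0 : ¬ ∀ᶠ z in 𝓝 (1 : ℂ), b (z, -2) = 0)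
    (hs0 : ¬ ∀ᶠ z in 𝓝 (1 : ℂ), s (z, -2) = 0) (ht0 : ¬ ∀ᶠ z in 𝓝 (1 : ℂ), t (z, -2) = 0)
    (hE : ∀ᶠ q in 𝓝 ((1, -2) : ℂ × ℂ), (q.1 ^ 3 + q.2 * q.1 ^ 2 + q.1) * s q ^ 2 * b q ^ 3 =
      t q ^ 2 * (a q ^ 3 + q.2 * a q ^ 2 * b q + a q * b q ^ 2)) :
    ∃ F : ℂ × ℂ → ℂ, AnalyticAt ℂ F (1, -2) ∧ MeroEqAt (fun q =>
      (partialZ a q * b q - a q * partialZ b q) * t q / (b q ^ 2 * s q)) F (1, -2) := by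
  obtain ⟨ε, hε, hball⟩ := Metric.eventually_nhds_iff_ball.1
    ((ha.eventually_analyticAt.and hb.eventually_analyticAt).and
      ((hs.eventually_analyticAt.and ht.eventually_analyticAt).and hE.eventually_nhds))
  have hline : ∀ᶠ z in 𝓝[≠] (1 : ℂ), b (z, -2) * s (z, -2) * t (z, -2) ≠ 0 := by
    filter_upwards [hb.along_fst.eventually_ne_zero_of_not_eventually_zero hb0,
      hs.along_fst.eventually_ne_zero_of_not_eventually_zero hs0, ht.along_fst.eventually_ne_zero_of_not_eventually_zero ht0]
      with z h1 h2 h3 using mul_ne_zero (mul_ne_zero h1 h2) h3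
  obtain ⟨r', hr', hr'b⟩ := Metric.eventually_nhds_iff_ball.1 (eventually_nhdsWithin_iff.1 hline)
  obtain ⟨r, hr, hrr⟩ := exists_between (lt_min hε hr')
  have hrε : r < ε := hrr.trans_le (min_le_left _ _)
  have hrr' : r < r' := hrr.trans_le (min_le_right _ _)
  let n : Set (ℂ × ℂ) := ball (1, -2) ε ∩ (fun q => b q * s q * t q) ⁻¹' {0}ᶜ
  have hnopen : IsOpen n := by
    refine ContinuousOn.isOpen_inter_preimage (fun q hq => ?_) isOpen_ball isOpen_compl_singleton
    obtain ⟨⟨-, h2⟩, ⟨h3, h4⟩, -⟩ := hball q hq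
    exact ((h2.continuousAt.mul h3.continuousAt).mul h4.continuousAt).continuousWithinAt
  have hsub : sphere (1 : ℂ) r ×ˢ {(-2 : ℂ)} ⊆ n := by
    rintro ⟨z, w⟩ ⟨hz, hw⟩
    obtain rfl : w = -2 := hw
    refine ⟨?_, ?_⟩
    · rw [← ball_prod_same]
      exact ⟨sphere_subset_closedBall.trans (closedBall_subset_ball hrε) hz, mem_ball_self hε⟩
    · exact hr'b z (sphere_subset_closedBall.trans (closedBall_subset_ball hrr') hz)
        (ne_of_mem_sphere hz hr.ne')
  obtain ⟨u, v, -, hv, hu', hv', huv⟩ := generalized_tube_lemma (isCompact_sphere (1 : ℂ) r)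
    isCompact_singleton hnopen hsub
  obtain ⟨ρ', hρ', hρv⟩ := Metric.isOpen_iff.1 hv (-2) (hv' rfl)
  obtain ⟨ρ, hρ, hρρ⟩ := exists_between (lt_min hρ' (lt_min hε (by norm_num : (0 : ℝ) < 4)))
  have hρ1 : ρ < ρ' := hρρ.trans_le (min_le_left _ _)
  have hρε : ρ < ε := hρρ.trans_le ((min_le_right _ _).trans (min_le_left _ _))
  have hρ4 : ρ < 4 := hρρ.trans_le ((min_le_right _ _).trans (min_le_right _ _))
  have hmem : ∀ z ∈ closedBall (1 : ℂ) r, ∀ η ∈ closedBall (-2 : ℂ) ρ,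
      ((z, η) : ℂ × ℂ) ∈ ball ((1, -2) : ℂ × ℂ) ε := fun z hz η hη => by
    rw [← ball_prod_same]
    exact ⟨closedBall_subset_ball hrε hz, closedBall_subset_ball hρε hη⟩
  have hnz : ∀ z ∈ sphere (1 : ℂ) r, ∀ η ∈ closedBall (-2 : ℂ) ρ,
      b (z, η) * s (z, η) * t (z, η) ≠ 0 := fun z hz η hη =>
    (huv ⟨hu' hz, hρv (closedBall_subset_ball hρ1 hη)⟩).2
  let A : ℂ × ℂ → ℂ := fun q =>
    (partialZ a q * b q - a q * partialZ b q) * t q / (b q ^ 2 * s q)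
  have hAan : ∀ q ∈ ball ((1, -2) : ℂ × ℂ) ε, b q ≠ 0 → s q ≠ 0 → AnalyticAt ℂ A q :=
    fun q hq hbq hsq => by
      obtain ⟨⟨h1, h2⟩, ⟨h3, h4⟩, -⟩ := hball q hq
      exact (((h1.partialZ.mul h2).sub (h1.mul h2.partialZ)).mul h4).div ((h2.pow 2).mul h3)
        (mul_ne_zero (pow_ne_zero _ hbq) hsq)
  obtain ⟨F, hF, hFA⟩ := exists_analytic_extension (A := A) (c := 1) (d := -2) hr hρ
    (S := ball (-2) ρ \ {-2}) Set.sdiff_subset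
    (fun ζ hζ η hη => by
      have h := hnz ζ hζ η hη
      exact hAan _ (hmem ζ (sphere_subset_closedBall hζ) η hη)
        (left_ne_zero_of_mul (left_ne_zero_of_mul h)) (right_ne_zero_of_mul (left_ne_zero_of_mul h)))
    (fun η hη ζ hζ => by
      obtain ⟨⟨h1, h2⟩, ⟨h3, h4⟩, -⟩ := hball _ (hmem ζ hζ η (ball_subset_closedBall hη.1))
      exact (((h1.partialZ.mul h2).sub (h1.mul h2.partialZ)).mul h4).along_fst.meromorphicAt.fun_div
        ((h2.pow 2).mul h3).along_fst.meromorphicAt)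
    (fun η hη ζ hζ => by
      have hηc := ball_subset_closedBall hη.1
      have hηne : η + 2 ≠ 0 := fun h => hη.2 (eq_neg_of_add_eq_zero_left h)
      have hsph : (1 + r : ℂ) ∈ sphere (1 : ℂ) r := by simp [abs_of_pos hr]
      have h := hnz _ hsph η hηc
      have hsl : Tendsto (fun z => (z, η)) (𝓝 ζ) (𝓝 (ζ, η)) :=
        Continuous.tendsto' (by fun_prop) _ _ rfl
      refine meromorphicOrderAt_slice_nonneg (convex_closedBall (1 : ℂ) r).isPreconnected
        (fun z hz => (hball _ (hmem z hz η hηc)).1.1) (fun z hz => (hball _ (hmem z hz η hηc)).1.2)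
        (fun z hz => (hball _ (hmem z hz η hηc)).2.1.1)
        (fun z hz => (hball _ (hmem z hz η hηc)).2.1.2)
        (sphere_subset_closedBall hsph) (left_ne_zero_of_mul (left_ne_zero_of_mul h))
        (right_ne_zero_of_mul (left_ne_zero_of_mul h)) (right_ne_zero_of_mul h)
        (mem_closedBall_self hr.le) (fun h => hηne (by linear_combination h)) (fun h4 => ?_) hζ
        (hsl.eventually (hball _ (hmem ζ hζ η hηc)).2.2)
      -- `η² = 4` and `η ≠ -2` leave `η = 2`, which lies outside the disc since `ρ < 4`.
      have h2 : η - 2 = 0 := by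
        apply (mul_eq_zero.1 (_ : (η + 2) * (η - 2) = 0)).resolve_left hηne
        linear_combination h4
      rw [sub_eq_zero.1 h2] at hη
      have := hη.1
      rw [mem_ball, dist_eq_norm] at this
      norm_num at this
      linarith)
  have hp : ball (1 : ℂ) r ×ˢ ball (-2 : ℂ) ρ ∈ 𝓝 ((1, -2) : ℂ × ℂ) :=
    (isOpen_ball.prod isOpen_ball).mem_nhds ⟨mem_ball_self hr, mem_ball_self hρ⟩
  have hFp := hF (1, -2) ⟨mem_ball_self hr, mem_ball_self hρ⟩
  have hdan : AnalyticAt ℂ (fun q : ℂ × ℂ => q.2 - (-2)) (1, -2) :=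
    analyticAt_snd.sub analyticAt_const
  refine ⟨F, hFp, fun q => (q.2 - (-2)) * (b q * s q), hdan.mul (hb.mul hs),
    not_eventually_mul_eq_zero hdan (hb.mul hs)
      (by simpa only [pow_one] using not_eventually_sub_pow_eq_zero (1, -2) 1)
      (not_eventually_mul_eq_zero hb hs
      (not_eventually_zero_of_slice hb0) (not_eventually_zero_of_slice hs0)), ?_⟩
  · filter_upwards [hp] with q hq hne
    have hq2 : q.2 ≠ -2 := sub_ne_zero.1 (left_ne_zero_of_mul hne)
    have hbs := right_ne_zero_of_mul hne
    have hA := hAan q (hmem q.1 (ball_subset_closedBall hq.1) q.2 (ball_subset_closedBall hq.2))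
      (left_ne_zero_of_mul hbs) (right_ne_zero_of_mul hbs)
    exact ((hA.along_fst.continuousAt.eventuallyEq_nhds_iff_eventuallyEq_nhdsNE
      (hF q hq).along_fst.continuousAt).1 (hFA q.2 ⟨hq.2, hq2⟩ q.1 hq.1).symm).eq_of_nhds

/-- The value at `(1, -2)` of the analytic representative of `x_z / y` is computed on the line
`δ = -2`, where the cubic `x³ + δx² + x` becomes `x(x-1)²`. -/
theorem exists_int_value {a b s t F : ℂ × ℂ → ℂ}
    (ha : AnalyticAt ℂ a (1, -2)) (hb : AnalyticAt ℂ b (1, -2)) (hs : AnalyticAt ℂ s (1, -2))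
    (ht : AnalyticAt ℂ t (1, -2)) (hF : AnalyticAt ℂ F (1, -2))
    (hb0 : ¬ ∀ᶠ z in 𝓝 (1 : ℂ), b (z, -2) = 0)
    (hs0 : ¬ ∀ᶠ z in 𝓝 (1 : ℂ), s (z, -2) = 0) (ht0 : ¬ ∀ᶠ z in 𝓝 (1 : ℂ), t (z, -2) = 0)
    (hE : ∀ᶠ q in 𝓝 ((1, -2) : ℂ × ℂ), (q.1 ^ 3 + q.2 * q.1 ^ 2 + q.1) * s q ^ 2 * b q ^ 3 =
      t q ^ 2 * (a q ^ 3 + q.2 * a q ^ 2 * b q + a q * b q ^ 2))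
    (hFA : MeroEqAt (fun q => (partialZ a q * b q - a q * partialZ b q) * t q / (b q ^ 2 * s q))
      F (1, -2)) : ∃ n : ℤ, F (1, -2) = n := by
  have hmul : ∀ᶠ q in 𝓝 ((1, -2) : ℂ × ℂ),
      (partialZ a q * b q - a q * partialZ b q) * t q = F q * (b q ^ 2 * s q) := by
    obtain ⟨c, hc, hc0, hce⟩ := hFA
    refine eventuallyEq_of_eventually_ne_zero (c := fun q => c q * (b q * s q))
      (((ha.partialZ.mul hb).sub (ha.mul hb.partialZ)).mul ht) (by fun_prop) (by fun_prop)
      (not_eventually_mul_eq_zero hc (by fun_prop) hc0 (not_eventually_mul_eq_zero hb hs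
      (not_eventually_zero_of_slice hb0) (not_eventually_zero_of_slice hs0))) ?_
    filter_upwards [hce] with q h hne
    have hbs := right_ne_zero_of_mul hne
    rw [← h (left_ne_zero_of_mul hne), div_mul_cancel₀]
    exact mul_ne_zero (pow_ne_zero _ (left_ne_zero_of_mul hbs)) (right_ne_zero_of_mul hbs)
  have hsl := tendsto_prodMk_left_nhdsNE (1, -2)
  have hbn := hb.along_fst.eventually_ne_zero_of_not_eventually_zero hb0
  have hsn := hs.along_fst.eventually_ne_zero_of_not_eventually_zero hs0
  have htn := ht.along_fst.eventually_ne_zero_of_not_eventually_zero ht0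
  refine exists_int_eq_of_nodal (ha.along_fst.meromorphicAt.fun_div hb.along_fst.meromorphicAt)
    (hs.along_fst.meromorphicAt.fun_div ht.along_fst.meromorphicAt) hF.along_fst ?_ ?_ ?_
  · filter_upwards [hsn, htn] with z h1 h2 using div_ne_zero h1 h2
  · filter_upwards [hbn, htn, hsl.eventually hE] with z h1 h2 h3
    field_simp
    linear_combination h3
  · filter_upwards [hbn, htn, hsl.eventually hmul, hsl.eventually ha.eventually_analyticAt,
      hsl.eventually hb.eventually_analyticAt] with z h1 h2 h3 h4 h5
    rw [deriv_slice_div h4 h5 h1]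
    field_simp
    linear_combination -h3

theorem lemma4p7 (B : Set (ℂ × ℂ)) (hB : IsConnected B)
    (hline : ∀ z : ℂ, (z, (-2 : ℂ)) ∈ B)
    (x y : ℂ × ℂ → ℂ) (hx : MeroNear B x) (hy : MeroNear B y)
    (hMD : ManinDenef B x y)
    (hord : NeitherZeroNorPole y (-2)) :
    ∃ n : ℤ, HasValueAt (quotA x y) (1, -2) n ∧
      HasValueZThenDelta (quotA x y) (1, -2) n ∧
      HasValueDeltaThenZ (quotA x y) (1, -2) n := by
  obtain ⟨U, -, hBU, hxU⟩ := hx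
  obtain ⟨V, -, hBV, hE⟩ := hMD
  have hxp := hxU _ (hBU (hline 1))
  have hEp := hE _ (hBV (hline 1))
  obtain ⟨s, t, hs, ht, hs0, ht0, hyst⟩ := hord 1
  simp only [zpow_zero, one_mul] at hyst
  obtain ⟨a, b, ha, hb, hb0, hxab⟩ := exists_div_of_maninDenef hxp hs ht ht0 hyst hEp
  have hb0' := not_eventually_zero_of_slice hb0
  have hnum := maninDenef_numerators ha hb hs ht hb0' (not_eventually_zero_of_slice ht0)
    hxab hyst hEp
  obtain ⟨F, hF, hAF⟩ := exists_analytic_quotient ha hb hs ht hb0 hs0 ht0 hnum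
  obtain ⟨n, hn⟩ := exists_int_value ha hb hs ht hF hb0 hs0 ht0 hnum hAF
  have hqF : MeroEqAt (quotA x y) F (1, -2) := (meroEqAt_quotA ha hb hb0' hxab hyst).trans hAF
  have hqF1 : MeroEqAt (quotA x y) (fun q => F q / (fun _ => 1) q) (1, -2) := by simpa using hqF
  have h1 : ∀ {z : ℂ}, ¬ ∀ᶠ _ in 𝓝 z, (1 : ℂ) = 0 := fun h => one_ne_zero h.self_of_nhds
  refine ⟨n, ⟨F, hF, hqF, hn⟩,
    ⟨_, ⟨F, fun _ => 1, hF, analyticAt_const, h1, hqF1, EventuallyEq.rfl⟩, ?_⟩,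
    ⟨_, ⟨F, fun _ => 1, hF, analyticAt_const, h1, hqF1, EventuallyEq.rfl⟩, ?_⟩⟩
  · have := hF.along_snd.continuousAt.tendsto.mono_left (nhdsWithin_le_nhds (s := {(-2 : ℂ)}ᶜ))
    simpa [hn] using this
  · have := hF.along_fst.continuousAt.tendsto.mono_left (nhdsWithin_le_nhds (s := {(1 : ℂ)}ᶜ))
    simpa [hn] using this
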